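/- Let $\Bbbk$ be a field and let $n\ge 3$. Put $\zeta=(1\,2\,\cdots\,n)\in\mathfrak S_n$ and compose permutations from right to left. A quasi-diagram is a permutation $\alpha\in\mathfrak S_n$ with $\alpha^2=\mathrm{id}$; let $\mathfrak D_n$ be the set of all of them. A chord diagram is a quasi-diagram without fixed points. A quasi-diagram $\alpha$ is maximal if $\zeta\alpha$ has exactly one orbit on $\{1,\dots,n\}$. Let $\mathfrak M_n\subset\mathfrak D_n$ be the set of maximal chord diagrams. For $\alpha\in\mathfrak D_n$ let $A_\alpha$ be the gentle $\Bbbk$-algebra with one maximal path associated with $\alpha$: identify the path algebra of the quiver $1\to 2\to\cdots\to n$ (paths composed from left to right) with the algebra of upper triangular $n\times n$ matrices over $\Bbbk$, and let $A_\alpha$ be the subalgebra of those upper triangular matrices $M$ with $M_{\alpha(i),\alpha(i)}=M_{i,i}$ for all $i$. It is graded by path length (the matrix unit $E_{ij}$ has degree $j-i$). Let $A_{\alpha,0}=A_\alpha/A_{\alpha,\ge 1}$, a right $A_\alpha$-module. The Koszul dual of $A_\alpha$ is the Yoneda algebra $A_\alpha^!=\operatorname{Ext}^*_{A_\alpha}(A_{\alpha,0},A_{\alpha,0})$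 of right modules, in which the product $xy$ is $y$ followed by $x$. If $A_\alpha^!\cong A_\beta$ as $\Bbbk$-algebras for some $\beta\in\mathfrak D_n$, then we say that the Koszul dual of $\alpha$ exists and write $\alpha^!=\beta$. Let $E\subset\mathfrak D_n$ be a nonempty set that is - closed under rotations: $\zeta^l\alpha\zeta^{-l}\in E$ for all $\alpha\in E$ and $l\in\mathbb Z$; and - closed under taking Koszul duals: for every $\alpha\in E$ the Koszul dual $\alpha^!$ exists and lies in $E$. Then $n=4g$ for some integer $g$, and $E\subset\mathfrak M_{4g}$. -/

import Mathlib

universe u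

namespace QuasiDiagram

open Equiv CategoryTheory
open scoped DirectSum

/-! ### Quasi-diagrams

The points `1, …, n` are the elements `0, …, n - 1` of `Fin n`, and the `n`-cycle
`ζ = (1 2 ⋯ n)` is `finRotate n`, that is, `i ↦ i + 1`. -/

/-- The set of quasi-diagrams of size `n`: permutations `α` with `α² = id`. -/
def quasiDiagrams (n : ℕ) : Set (Perm (Fin n)) := {α | α * α = 1}

/-- The faces of `α`: the orbits of `ζα` (fixed points included). -/
def faces {n : ℕ} (α : Perm (Fin n)) : Set (Set (Fin n)) :=
  Set.range fun i => {j | (finRotate n * α).SameCycle i j}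

/-- `α` is maximal if it has exactly one face. -/
def IsMaximal {n : ℕ} (α : Perm (Fin n)) : Prop := ∃ w, faces α = {w}

/-- The set of maximal chord diagrams of size `n`: quasi-diagrams which have no isolated point
(a chord diagram) and exactly one face. -/
def maximalChordDiagrams (n : ℕ) : Set (Perm (Fin n)) :=
  {α | α ∈ quasiDiagrams n ∧ (∀ i, α i ≠ i) ∧ IsMaximal α}

/-- `E` is closed under rotations: it is stable under conjugation by all powers of `ζ`. -/
def ClosedUnderRotations {n : ℕ} (E : Set (Perm (Fin n))) : Prop :=
  ∀ α ∈ E, ∀ l : ℤ, finRotate n ^ l * α * (finRotate n ^ l)⁻¹ ∈ E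

/-! ### The gentle algebra of a quasi-diagram -/

section Algebra

variable (k : Type u) [Field k] {n : ℕ}

/-- The gentle algebra with one maximal path attached to `α`. The path algebra of the linear
quiver `1 → 2 → ⋯ → n` (paths composed from left to right) is the algebra of upper triangular
matrices, the matrix unit `E i j` being the path from `i` to `j`. Gluing the vertices along `α`
gives the subalgebra spanned by the radical (the strictly upper triangular matrices) and the
idempotents `E i i + E (α i) (α i)` for `α i ≠ i` and `E i i` for `α i = i`; it consists of the
upper triangular matrices whose diagonal is invariant under `α`. -/
def gentleAlgebra (α : Perm (Fin n)) : Subalgebra k (Matrix (Fin n) (Fin n) k) where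
  carrier := {M | (∀ i j, j < i → M i j = 0) ∧ ∀ i, M (α i) (α i) = M i i}
  mul_mem' := by
    rintro M N ⟨hM, hM'⟩ ⟨hN, hN'⟩
    have diag : ∀ i, (M * N) i i = M i i * N i i := by
      intro i
      rw [Matrix.mul_apply]
      refine Finset.sum_eq_single i (fun j _ hj => ?_) (fun h => absurd (Finset.mem_univ i) h)
      rcases lt_or_gt_of_ne hj with h | h
      · rw [hM i j h, zero_mul]
      · rw [hN j i h, mul_zero]
    refine ⟨fun i j hij => ?_, fun i => by rw [diag, diag, hM', hN']⟩
    rw [Matrix.mul_apply]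
    refine Finset.sum_eq_zero fun l _ => ?_
    rcases lt_or_ge l i with h | h
    · rw [hM i l h, zero_mul]
    · rw [hN l j (lt_of_lt_of_le hij h), mul_zero]
  add_mem' := by
    rintro M N ⟨hM, hM'⟩ ⟨hN, hN'⟩
    refine ⟨fun i j hij => ?_, fun i => ?_⟩
    · rw [Matrix.add_apply, hM i j hij, hN i j hij, add_zero]
    · rw [Matrix.add_apply, Matrix.add_apply, hM', hN']
  algebraMap_mem' := by
    intro c
    refine ⟨fun i j hij => ?_, fun i => ?_⟩
    · rw [Matrix.algebraMap_matrix_apply, if_neg hij.ne']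
    · rw [Matrix.algebraMap_matrix_apply, Matrix.algebraMap_matrix_apply, if_pos rfl, if_pos rfl]

/-- The part `A_{≥ 1}` of `A = gentleAlgebra k α` in positive path length, as a right ideal, i.e.
as an `Aᵐᵒᵖ`-submodule of `A`: the matrices in `A` with zero diagonal. -/
def positivePart (α : Perm (Fin n)) :
    Submodule (gentleAlgebra k α)ᵐᵒᵖ (gentleAlgebra k α) where
  carrier := {M | ∀ i, M.1 i i = 0}
  zero_mem' := fun _ => rfl
  add_mem' := by
    intro M N hM hN i
    change M.1 i i + N.1 i i = 0
    rw [hM i, hN i, add_zero]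
  smul_mem' := by
    intro c M hM i
    change (M.1 * c.unop.1) i i = 0
    rw [Matrix.mul_apply]
    refine Finset.sum_eq_zero fun j _ => ?_
    rcases lt_trichotomy j i with h | h | h
    · rw [M.2.1 i j h, zero_mul]
    · rw [h, hM i, zero_mul]
    · rw [c.unop.2.1 j i h, mul_zero]

/-- The degree zero part `A_0 = A / A_{≥ 1}` of `A = gentleAlgebra k α` as a right `A`-module,
right `A`-modules being modules over `Aᵐᵒᵖ`. -/
abbrev degreeZero (α : Perm (Fin n)) : ModuleCat.{u} (gentleAlgebra k α)ᵐᵒᵖ :=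
  ModuleCat.of (gentleAlgebra k α)ᵐᵒᵖ (gentleAlgebra k α ⧸ positivePart k α)

/-- The Yoneda algebra `Ext_A(M, M) = ⨁ i, Ext^i_A(M, M)` of a right module `M` over a `k`-algebra
`A` is isomorphic to the `k`-algebra `B`: there is a `k`-linear bijection that respects units and
products. The Yoneda product `x * y` is the composition of `y` followed by `x`, which Mathlib
writes `y.comp x`; by bilinearity it suffices to consider homogeneous elements. -/
def YonedaAlgebraIsoTo {A : Type u} [Ring A] [Algebra k A] (M : ModuleCat.{u} Aᵐᵒᵖ)
    (B : Type u) [Ring B] [Algebra k B] : Prop :=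
  ∃ φ : (⨁ i : ℕ, Abelian.Ext.{u} M M i) ≃ₗ[k] B,
    φ (DirectSum.lof k ℕ (fun i => Abelian.Ext.{u} M M i) 0 (Abelian.Ext.mk₀ (𝟙 M))) = 1 ∧
    ∀ (i j m : ℕ) (h : j + i = m) (x : Abelian.Ext.{u} M M i) (y : Abelian.Ext.{u} M M j),
      φ (DirectSum.lof k ℕ (fun i => Abelian.Ext.{u} M M i) m (y.comp x h)) =
        φ (DirectSum.lof k ℕ (fun i => Abelian.Ext.{u} M M i) i x) *
          φ (DirectSum.lof k ℕ (fun i => Abelian.Ext.{u} M M i) j y)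

/-- The Koszul dual quasi-diagram of `α` exists and is `β`: the Koszul dual
`A^! = Ext_A(A_0, A_0)` of the gentle algebra `A` of `α` is isomorphic to the gentle algebra
(with one maximal path) of the quasi-diagram `β`. -/
def IsKoszulDual (α β : Perm (Fin n)) : Prop :=
  β ∈ quasiDiagrams n ∧ YonedaAlgebraIsoTo k (degreeZero k α) (gentleAlgebra k β)

/-- `E` is closed under taking Koszul duals: every member of `E` has a Koszul dual
quasi-diagram, and it lies in `E`. -/
def ClosedUnderKoszulDual (E : Set (Perm (Fin n))) : Prop :=
  ∀ α ∈ E, ∃ β ∈ E, IsKoszulDual k α β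

end Algebra

end QuasiDiagram

/-! With 0-based indices, write `R_i` for the strictly upper triangular matrices supported on row
`i`. As a right module, `A_{≥ 1}` is the direct sum of the `R_i`, and for `i + 1 < n` left
multiplication by the arrow `E i (i + 1)` covers `R_i` by an indecomposable projective. Its kernel
is `R_{α (i + 1)}`, or zero if `i + 1` is fixed by `α`. As `A_0` is killed by `A_{≥ 1}`, these
covers shift `Ext` by one degree, so `dim Ext^{m+1}(A_0, A_0)` is the number `c_m` of `i` with
`Alive α m i` (`finrank_ext_degreeZero`).

Suppose this Yoneda algebra is isomorphic to `A_β`. The isomorphism need not be graded, but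
comparing nilpotent elements matches the part of positive degree with the strictly upper triangular
matrices (`sum_card_alive_eq`). Hence `∑ c_m = n(n-1)/2` and `c_m` is eventually zero. Since `c_0 ≤
n - 1` and the `c_m` strictly decrease until they vanish, `c_m ≤ n - 1 - m`; the sum forces
equality, and `c_1 = n - 2` says that only one arrow lacks a continuation (`eq_of_not_alive_one`).

A fixed point could be rotated so that uniqueness of this arrow, followed by one more rotation,
yields an arrow continuing itself forever, which is impossible (`forall_ne_of_closed`). Without
fixed points, a chain of arrows `i ↦ α (i + 1)` can stop only at the last index, so finiteness makes
`αζ`, hence its conjugate `ζα`, a single cycle. Comparing signs gives `4 ∣ n`. -/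

namespace QuasiDiagram

open Equiv CategoryTheory Module
open scoped DirectSum

/-! ### Dimension shifting and finite direct sums for `Ext`. -/

section Homological

variable (k : Type u) [Field k] {B : Type u} [Ring B] [Algebra k B]

/-- The connecting map of a short exact sequence with projective middle term is bijective in all
degrees if every map from the middle term vanishes on the first one. -/
noncomputable def extShiftEquiv {S : ShortComplex (ModuleCat.{u} B)} (hS : S.ShortExact)
    [Projective S.X₂] (Y : ModuleCat.{u} B) (h : ∀ f : S.X₂ ⟶ Y, S.f ≫ f = 0) (m : ℕ) :
    Abelian.Ext.{u} S.X₁ Y m ≃ₗ[k] Abelian.Ext.{u} S.X₃ Y (m + 1) :=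
  LinearEquiv.ofBijective
    (Abelian.Ext.precompOfLinear hS.extClass k Y (add_comm 1 m)) (by
      constructor
      · rw [injective_iff_map_eq_zero]
        intro x hx
        obtain ⟨y, rfl⟩ := Abelian.Ext.contravariant_sequence_exact₁ hS Y x (add_comm 1 m) hx
        cases m with
        | zero =>
          obtain ⟨f, rfl⟩ := (Abelian.Ext.mk₀_bijective _ _).2 y
          rw [Abelian.Ext.mk₀_comp_mk₀, h, Abelian.Ext.mk₀_zero]
        | succ m => rw [Abelian.Ext.eq_zero_of_projective y, Abelian.Ext.comp_zero]
      · exact fun x => Abelian.Ext.contravariant_sequence_exact₃ hS Y x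
          (Abelian.Ext.eq_zero_of_projective _) (add_comm 1 m))

theorem subsingleton_ext_of_subsingleton (X Y : ModuleCat.{u} B) [Subsingleton X] (m : ℕ) :
    Subsingleton (Abelian.Ext.{u} X Y m) := by
  refine subsingleton_of_forall_eq 0 fun x => ?_
  have : 𝟙 X = 0 := by
    ext a
    exact Subsingleton.elim _ _
  rw [← Abelian.Ext.mk₀_id_comp x, this, Abelian.Ext.mk₀_zero, Abelian.Ext.zero_comp]

/-- `Ext` turns a finite direct sum in the first variable into a product. -/
noncomputable def extPiEquiv {ι : Type} [Fintype ι] [DecidableEq ι] (X Y : ModuleCat.{u} B)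
    (Z : ι → ModuleCat.{u} B) (f : ∀ i, Z i ⟶ X) (p : ∀ i, X ⟶ Z i)
    (hfp : ∀ i, f i ≫ p i = 𝟙 _) (hfp' : ∀ i j, i ≠ j → f i ≫ p j = 0)
    (hsum : ∑ i, p i ≫ f i = 𝟙 X) (m : ℕ) :
    Abelian.Ext.{u} X Y m ≃ₗ[k] ∀ i, Abelian.Ext.{u} (Z i) Y m where
  toFun e i := (Abelian.Ext.mk₀ (f i)).comp e (zero_add m)
  invFun e := ∑ i, (Abelian.Ext.mk₀ (p i)).comp (e i) (zero_add m)
  left_inv x := by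
    simp only [← Abelian.Ext.comp_assoc_of_second_deg_zero, Abelian.Ext.mk₀_comp_mk₀]
    rw [← Abelian.Ext.sum_comp, ← Abelian.Ext.mk₀_sum, hsum, Abelian.Ext.mk₀_id_comp]
  right_inv _ := by
    ext i
    simp only [Abelian.Ext.comp_sum, ← Abelian.Ext.comp_assoc_of_second_deg_zero,
      Abelian.Ext.mk₀_comp_mk₀]
    rw [Finset.sum_eq_single i _ (by simp), hfp, Abelian.Ext.mk₀_id_comp]
    intro j _ hij
    rw [hfp' i j hij.symm, Abelian.Ext.mk₀_zero, Abelian.Ext.zero_comp]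
  map_add' _ _ := by
    ext i
    simp only [Abelian.Ext.comp_add, Pi.add_apply]
  map_smul' _ _ := by
    ext i
    simp only [Abelian.Ext.comp_smul, Pi.smul_apply, RingHom.id_apply]

end Homological

/-! ### Right ideals supported on given rows. -/

section Modules

variable {k : Type u} [Field k] {n : ℕ} {α : Perm (Fin n)}

theorem gentleAlgebra_mul_diag (x y : gentleAlgebra k α) (i : Fin n) :
    (x * y).1 i i = x.1 i i * y.1 i i := by
  change (x.1 * y.1) i i = _
  rw [Matrix.mul_apply]
  refine Finset.sum_eq_single i (fun j _ hj => ?_) (fun h => absurd (Finset.mem_univ i) h)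
  rcases lt_or_gt_of_ne hj with h | h
  · rw [x.2.1 i j h, zero_mul]
  · rw [y.2.1 j i h, mul_zero]

variable (k α) in
/-- The right ideal of matrices whose rows outside `s` vanish. -/
def rows (s : Set (Fin n)) : Submodule (gentleAlgebra k α)ᵐᵒᵖ (gentleAlgebra k α) where
  carrier := {M | ∀ i ∉ s, ∀ j, M.1 i j = 0}
  zero_mem' := fun _ _ _ => rfl
  add_mem' := by
    intro M N hM hN i hi j
    change M.1 i j + N.1 i j = 0
    rw [hM i hi, hN i hi, add_zero]
  smul_mem' := by
    intro c M hM i hi j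
    change (M.1 * c.unop.1) i j = 0
    rw [Matrix.mul_apply]
    exact Finset.sum_eq_zero fun l _ => by rw [hM i hi, zero_mul]

variable (k α) in
/-- The right ideal of strictly upper triangular matrices whose rows outside `s` vanish. -/
def strictRows (s : Set (Fin n)) : Submodule (gentleAlgebra k α)ᵐᵒᵖ (gentleAlgebra k α) :=
  rows k α s ⊓ positivePart k α

/-- Left multiplication, as a map of right modules. -/
def lmul (c : gentleAlgebra k α) :
    gentleAlgebra k α →ₗ[(gentleAlgebra k α)ᵐᵒᵖ] gentleAlgebra k α where
  toFun x := c * x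
  map_add' := mul_add c
  map_smul' := fun a x => (mul_assoc c x a.unop).symm

instance : Module.Projective (gentleAlgebra k α)ᵐᵒᵖ (gentleAlgebra k α) :=
  Module.Projective.of_equiv
    (MulOpposite.opLinearEquiv (gentleAlgebra k α)ᵐᵒᵖ : _ ≃ₗ[(gentleAlgebra k α)ᵐᵒᵖ] _).symm

open Classical in
/-- The idempotent attached to an invariant set of indices. -/
noncomputable def idem (s : Set (Fin n)) (hs : ∀ i, α i ∈ s ↔ i ∈ s) : gentleAlgebra k α :=
  ⟨Matrix.diagonal fun i => if i ∈ s then 1 else 0, by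
    refine ⟨fun i j hij => Matrix.diagonal_apply_ne _ hij.ne', fun i => ?_⟩
    simp [hs]⟩

theorem idem_mul {s : Set (Fin n)} (hs : ∀ i, α i ∈ s ↔ i ∈ s) {x : gentleAlgebra k α}
    (hx : x ∈ rows k α s) : idem s hs * x = x := by
  ext i j
  change ((Matrix.diagonal _ : Matrix (Fin n) (Fin n) k) * x.1) i j = _
  rw [Matrix.diagonal_mul]
  split_ifs with h
  · rw [one_mul]
  · rw [hx i h, zero_mul]

theorem idem_mul_mem {s : Set (Fin n)} (hs : ∀ i, α i ∈ s ↔ i ∈ s) (x : gentleAlgebra k α) :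
    idem s hs * x ∈ rows k α s := by
  intro i hi j
  change ((Matrix.diagonal _ : Matrix (Fin n) (Fin n) k) * x.1) i j = _
  rw [Matrix.diagonal_mul, if_neg hi, zero_mul]

/-- Invariance of `s` puts its diagonal idempotent in the algebra, and left multiplication by it
splits the inclusion into the free module of rank one. -/
theorem projective_rows {s : Set (Fin n)} (hs : ∀ i, α i ∈ s ↔ i ∈ s) :
    Module.Projective (gentleAlgebra k α)ᵐᵒᵖ (rows k α s) := by
  refine Module.Projective.of_split (rows k α s).subtype
    ((lmul (idem s hs)).codRestrict (rows k α s) (idem_mul_mem hs)) ?_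
  ext x : 2
  exact idem_mul hs x.2

/-- This makes maps from the projective covers to `A_0` vanish on syzygies, so that every connecting
map is bijective. -/
theorem smul_degreeZero_eq_zero {x : gentleAlgebra k α} (hx : x ∈ positivePart k α)
    (y : degreeZero k α) : MulOpposite.op x • y = 0 := by
  obtain ⟨y, rfl⟩ := Submodule.Quotient.mk_surjective _ y
  refine (Submodule.Quotient.mk_eq_zero _).2 fun i => ?_
  change (y * x).1 i i = 0
  rw [gentleAlgebra_mul_diag, hx i, mul_zero]

/-- The matrix unit `E i j`. -/
def unit (i j : Fin n) (hij : i < j) : gentleAlgebra k α :=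
  ⟨Matrix.single i j 1, by
    refine ⟨fun a b hab => ?_, fun a => ?_⟩
    · exact Matrix.single_apply_of_ne _ _ _ _ _ (by rintro ⟨rfl, rfl⟩; exact absurd hij hab.asymm)
    · rw [Matrix.single_apply_of_ne _ _ _ _ _ (by rintro ⟨h, h'⟩; exact hij.ne (h.trans h'.symm)),
        Matrix.single_apply_of_ne _ _ _ _ _ (by rintro ⟨h, h'⟩; exact hij.ne (h.trans h'.symm))]⟩

theorem unit_mul_same {i j : Fin n} (hij : i < j) (x : gentleAlgebra k α) (b : Fin n) :
    (unit i j hij * x).1 i b = x.1 j b := by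
  change ((Matrix.single i j 1 : Matrix (Fin n) (Fin n) k) * x.1) i b = _
  simp

theorem unit_mul_of_ne {i j a : Fin n} (hij : i < j) (x : gentleAlgebra k α) (h : a ≠ i)
    (b : Fin n) : (unit i j hij * x).1 a b = 0 := by
  change ((Matrix.single i j 1 : Matrix (Fin n) (Fin n) k) * x.1) a b = _
  exact Matrix.single_mul_apply_of_ne _ _ _ _ _ h _

open Classical in
/-- The element of `A` whose row `i + 1` is the row `i` of `y`, and whose other rows vanish except
that the diagonal is made invariant. -/
noncomputable def shiftUp (hα : α * α = 1) {i j : Fin n} (hij : i.val + 1 = j.val)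
    (y : gentleAlgebra k α) (hy : y ∈ positivePart k α) : gentleAlgebra k α :=
  ⟨Matrix.of fun a b => if a = j then y.1 i b else if a = α j ∧ b = α j then y.1 i j else 0, by
    have hα' : ∀ a, α (α a) = a := fun a => congrArg (fun f => f a) hα
    refine ⟨fun a b hab => ?_, fun a => ?_⟩
    · simp only [Matrix.of_apply]
      split_ifs with h h'
      · subst h
        rcases eq_or_ne b i with rfl | hb
        · exact hy b
        · exact y.2.1 _ _ (by rw [Fin.lt_def] at *; rw [Ne, Fin.ext_iff] at hb; omega)
      · exact absurd hab (by rw [h'.1, h'.2]; exact lt_irrefl _)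
      · rfl
    · simp only [Matrix.of_apply, and_self]
      by_cases h1 : a = j
      · subst h1
        by_cases h2 : α a = a <;> simp [h2]
      · by_cases h2 : a = α j
        · subst h2
          simp +contextual [hα']
        · have h3 : α a ≠ j := fun h => h2 (by rw [← h, hα'])
          have h4 : α a ≠ α j := fun h => h1 (α.injective h)
          simp [h1, h2, h3, h4]⟩

theorem shiftUp_diag (hα : α * α = 1) {i j : Fin n} (hij : i.val + 1 = j.val)
    (y : gentleAlgebra k α) (hy : y ∈ positivePart k α) {a : Fin n} (ha : a = j ∨ a = α j) :
    (shiftUp hα hij y hy).1 a a = y.1 i j := by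
  rcases ha with rfl | rfl
  · simp [shiftUp]
  · simp only [shiftUp, Matrix.of_apply, and_self, if_true]
    split_ifs with h
    · rw [h]
    · rfl

theorem shiftUp_of_ne (hα : α * α = 1) {i j : Fin n} (hij : i.val + 1 = j.val)
    (y : gentleAlgebra k α) (hy : y ∈ positivePart k α) {a : Fin n} (h1 : a ≠ j) (h2 : a ≠ α j)
    (b : Fin n) : (shiftUp hα hij y hy).1 a b = 0 := by
  simp [shiftUp, h1, h2]

/-- Row `i` is thus a cyclic module generated by its arrow. This gives both the surjectivity of its
projective cover and the control of its maps to `A_0`. -/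
theorem unit_mul_shiftUp (hα : α * α = 1) {i j : Fin n} (hij : i.val + 1 = j.val)
    (y : gentleAlgebra k α) (hy : y ∈ strictRows k α {i}) :
    unit i j (Fin.lt_def.2 (by omega)) * shiftUp hα hij y hy.2 = y := by
  ext a b
  by_cases h : a = i
  · subst h
    rw [unit_mul_same]
    simp [shiftUp]
  · rw [unit_mul_of_ne _ _ h, hy.1 a h b]

end Modules

theorem finrank_ext_zero_eq_one (k : Type u) [Field k] {B : Type u} [Ring B] [Algebra k B]
    {X Y : ModuleCat.{u} B} (v : X ⟶ Y) (hv : v ≠ 0)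
    (h : ∀ f : X ⟶ Y, ∃ c : k, ∀ x, algebraMap k B c • v.hom x = f.hom x) :
    finrank k (Abelian.Ext.{u} X Y 0) = 1 := by
  refine (Abelian.Ext.linearEquiv₀ (R := k) (X := X) (Y := Y)).finrank_eq.trans ?_
  refine (finrank_eq_one_iff_of_nonzero' v hv).2 fun f => ?_
  obtain ⟨c, hc⟩ := h f
  exact ⟨c, ModuleCat.hom_ext (LinearMap.ext hc)⟩

/-! ### Syzygies of the rows and the dimensions of `Ext(A_0, A_0)`. -/

section Syzygies

variable {k : Type u} [Field k] {n : ℕ} {α : Perm (Fin n)}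

variable (k α) in
/-- The right ideal of strictly upper triangular matrices supported on the rows `s`, as a
module. -/
abbrev strictRowsMod (s : Set (Fin n)) : ModuleCat.{u} (gentleAlgebra k α)ᵐᵒᵖ :=
  ModuleCat.of _ (strictRows k α s)

theorem subsingleton_strictRows_of_forall (s : Set (Fin n)) (hs : ∀ i ∈ s, i.val + 1 = n) :
    Subsingleton (strictRows k α s) := by
  refine subsingleton_of_forall_eq 0 fun x => ?_
  ext a b
  change x.1.1 a b = 0
  by_cases ha : a ∈ s
  · rcases lt_or_ge b a with h | h
    · exact x.1.2.1 _ _ h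
    · have := hs a ha
      obtain rfl : b = a := by
        rw [Fin.le_def] at h
        rw [Fin.ext_iff]
        omega
      exact x.2.2 b
  · exact x.2.1 a ha b

theorem pair_invariant (hα : α * α = 1) (j a : Fin n) :
    α a ∈ ({j, α j} : Set (Fin n)) ↔ a ∈ ({j, α j} : Set (Fin n)) := by
  have hα' : ∀ a, α (α a) = a := fun a => congrArg (fun f => f a) hα
  have h : α a = j ↔ a = α j := ⟨fun h => by rw [← h, hα'], fun h => by rw [h, hα']⟩
  simp only [Set.mem_insert_iff, Set.mem_singleton_iff, α.injective.eq_iff, h]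
  exact or_comm

/-- The index of the syzygy of the row `i`, where `j = i + 1`. -/
def syzygyIndex (α : Perm (Fin n)) (j : Fin n) : Set (Fin n) := {a | a = α j ∧ a ≠ j}

theorem unit_mul_mem {i j : Fin n} (hij : i < j) (x : gentleAlgebra k α) :
    unit i j hij * x ∈ strictRows k α {i} := by
  refine ⟨fun a ha b => unit_mul_of_ne hij x ha b, fun a => ?_⟩
  by_cases h : a = i
  · subst h
    rw [unit_mul_same]
    exact x.2.1 _ _ hij
  · exact unit_mul_of_ne hij x h a

theorem strictRows_syzygy_le (j : Fin n) :
    strictRows k α (syzygyIndex α j) ≤ rows k α {j, α j} := by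
  intro x hx a ha b
  exact hx.1 a (fun h => ha (Or.inr h.1)) b

variable (k) in
/-- The sequence `0 → R_{α j} → e A → R_i → 0` (with zero instead of `R_{α j}` if `α j = j`),
where `j = i + 1` and `e` is the idempotent of the vertex of `j`. -/
def syzygyComplex (α : Perm (Fin n)) {i j : Fin n} (hij : i < j) :
    ShortComplex (ModuleCat.{u} (gentleAlgebra k α)ᵐᵒᵖ) where
  X₁ := strictRowsMod k α (syzygyIndex α j)
  X₂ := ModuleCat.of _ (rows k α {j, α j})
  X₃ := strictRowsMod k α {i}
  f := ModuleCat.ofHom (Submodule.inclusion (strictRows_syzygy_le j))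
  g := ModuleCat.ofHom (((lmul (unit i j hij)).codRestrict (strictRows k α {i})
    (unit_mul_mem hij)).comp (rows k α {j, α j}).subtype)
  zero := by
    ext x a b
    change (unit i j hij * x.1).1 a b = 0
    by_cases h : a = i
    · subst h
      rw [unit_mul_same]
      exact x.2.1 j (fun h => h.2 rfl) b
    · exact unit_mul_of_ne hij x.1 h b

/-- Left multiplication by `E i j` reads off row `j`, so its kernel consists of the elements whose
row `j` vanishes. The diagonal entry at `α j` equals the one at `j`, so it vanishes too, and what
remains is the strict part of row `α j`. -/
theorem syzygyComplex_shortExact (hα : α * α = 1) {i j : Fin n} (hij : i.val + 1 = j.val) :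
    (syzygyComplex k α (Fin.lt_def.2 (by omega) : i < j)).ShortExact := by
  refine ModuleCat.shortComplex_shortExact _ ?_ ?_ ?_
  · intro x
    constructor
    · intro hx
      have hx' : ∀ b, x.1.1 j b = 0 := fun b => by
        rw [← unit_mul_same (Fin.lt_def.2 (by omega) : i < j) x.1 b]
        exact congrArg (fun y : strictRows k α {i} => y.1.1 i b) hx
      refine ⟨⟨x.1, fun a ha b => ?_, fun a => ?_⟩, rfl⟩
      · by_cases h : a = j
        · rw [h, hx']
        · exact x.2 a (fun h' => h'.elim h fun h' => ha ⟨h', h⟩) b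
      · by_cases h : a = j
        · rw [h, hx']
        · by_cases h' : a = α j
          · rw [h', x.1.2.2, hx']
          · exact x.2 a (fun h'' => h''.elim h h') a
    · rintro ⟨y, rfl⟩
      exact congrArg (fun f => f.hom y)
        (syzygyComplex k α (Fin.lt_def.2 (by omega) : i < j)).zero
  · exact Submodule.inclusion_injective (strictRows_syzygy_le j)
  · intro y
    refine ⟨⟨shiftUp hα hij y.1 y.2.2, fun a ha b => ?_⟩, ?_⟩
    · exact shiftUp_of_ne hα hij _ _ (fun h => ha (Or.inl h)) (fun h => ha (Or.inr h)) b
    · exact Subtype.ext (unit_mul_shiftUp hα hij y.1 y.2)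

theorem syzygyComplex_comp_eq_zero (hα : α * α = 1) {i j : Fin n} (hij : i < j)
    (f : (syzygyComplex k α hij).X₂ ⟶ degreeZero k α) : (syzygyComplex k α hij).f ≫ f = 0 := by
  ext x
  -- Writing `x` as the idempotent acted on by `x` moves a radical element outside `f`, where it
  -- kills `A_0`.
  let e : rows k α {j, α j} := ⟨idem _ (pair_invariant hα j) * 1, idem_mul_mem _ 1⟩
  have hx : (syzygyComplex k α hij).f.hom x = MulOpposite.op x.1 • e := by
    refine Subtype.ext ?_
    change x.1 = idem _ (pair_invariant hα j) * 1 * x.1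
    rw [mul_one, idem_mul _ (strictRows_syzygy_le j x.2)]
  change f.hom ((syzygyComplex k α hij).f.hom x) = 0
  rw [hx]
  refine (map_smul f.hom _ _).trans ?_
  exact smul_degreeZero_eq_zero x.2.2 _

variable (k α) in
/-- The sequence `0 → A_{≥ 1} → A → A_0 → 0`. -/
def radicalComplex : ShortComplex (ModuleCat.{u} (gentleAlgebra k α)ᵐᵒᵖ) where
  X₁ := strictRowsMod k α Set.univ
  X₂ := ModuleCat.of _ (gentleAlgebra k α)
  X₃ := degreeZero k α
  f := ModuleCat.ofHom (strictRows k α Set.univ).subtype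
  g := ModuleCat.ofHom (positivePart k α).mkQ
  zero := by
    ext x
    exact (Submodule.Quotient.mk_eq_zero _).2 x.2.2

theorem radicalComplex_shortExact : (radicalComplex k α).ShortExact := by
  refine ModuleCat.shortComplex_shortExact _ ?_ ?_ ?_
  · intro x
    constructor
    · intro hx
      exact ⟨⟨x, fun a ha => absurd (Set.mem_univ a) ha,
        (Submodule.Quotient.mk_eq_zero _).1 hx⟩, rfl⟩
    · rintro ⟨y, rfl⟩
      exact (Submodule.Quotient.mk_eq_zero _).2 y.2.2
  · exact Subtype.val_injective
  · exact Submodule.mkQ_surjective _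

theorem radicalComplex_comp_eq_zero (f : (radicalComplex k α).X₂ ⟶ degreeZero k α) :
    (radicalComplex k α).f ≫ f = 0 := by
  ext x
  have hx : (radicalComplex k α).f.hom x =
      (MulOpposite.op x.1 • (1 : gentleAlgebra k α) : gentleAlgebra k α) := (one_mul x.1).symm
  change f.hom ((radicalComplex k α).f.hom x) = 0
  rw [hx]
  refine (map_smul f.hom _ _).trans ?_
  exact smul_degreeZero_eq_zero x.2.2 _

instance (i j : Fin n) (hij : i < j) [Fact (α * α = 1)] :
    Projective (syzygyComplex k α hij).X₂ :=
  have := projective_rows (k := k) (pair_invariant (Fact.out : α * α = 1) j)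
  ModuleCat.projective_of_categoryTheory_projective (ModuleCat.of _ (rows k α {j, α j}))

instance : Projective (radicalComplex k α).X₂ :=
  ModuleCat.projective_of_categoryTheory_projective
    (ModuleCat.of (gentleAlgebra k α)ᵐᵒᵖ (gentleAlgebra k α))

section RowProjection

open Classical in
/-- The matrix obtained from a strictly upper triangular one by keeping the row `i`. -/
noncomputable def keepRow (i : Fin n) :
    strictRows k α Set.univ →ₗ[(gentleAlgebra k α)ᵐᵒᵖ] strictRows k α {i} where
  toFun x := ⟨⟨Matrix.of fun a b => if a = i then x.1.1 a b else 0,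
      fun a b hab => by simp [x.1.2.1 a b hab], fun a => by simp [x.2.2 a, x.2.2 (α a)]⟩,
    fun a ha b => if_neg ha, fun a => by
      change (if a = i then x.1.1 a a else 0) = 0
      simp [x.2.2 a]⟩
  map_add' x y := by
    ext a b
    change (if a = i then x.1.1 a b + y.1.1 a b else 0) =
      (if a = i then x.1.1 a b else 0) + (if a = i then y.1.1 a b else 0)
    split_ifs <;> simp
  map_smul' c x := by
    ext a b
    change (if a = i then (x.1.1 * c.unop.1) a b else 0) =
      ((Matrix.of fun a b => if a = i then x.1.1 a b else 0) * c.unop.1) a b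
    simp only [Matrix.mul_apply, Matrix.of_apply]
    split_ifs <;> simp

theorem keepRow_apply (i a b : Fin n) (x : strictRows k α Set.univ) :
    (keepRow i x).1.1 a b = if a = i then x.1.1 a b else 0 := by
  simp only [keepRow]
  change (if a = i then x.1.1 a b else 0) = _
  congr

theorem strictRows_le_univ (i : Fin n) : strictRows k α {i} ≤ strictRows k α Set.univ :=
  fun _ hx => ⟨fun a ha => absurd (Set.mem_univ a) ha, hx.2⟩

end RowProjection

variable (k α) in
/-- `Ext` of the radical is the product of the `Ext` of its rows. -/
noncomputable def extRowsEquiv (Y : ModuleCat.{u} (gentleAlgebra k α)ᵐᵒᵖ) (m : ℕ) :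
    Abelian.Ext.{u} (strictRowsMod k α Set.univ) Y m ≃ₗ[k]
      ∀ i, Abelian.Ext.{u} (strictRowsMod k α {i}) Y m :=
  extPiEquiv k _ _ (fun i => strictRowsMod k α {i})
    (fun i => ModuleCat.ofHom (Submodule.inclusion (strictRows_le_univ i)))
    (fun i => ModuleCat.ofHom (keepRow i))
    (by
      intro i
      ext x a b
      refine (keepRow_apply i a b _).trans ?_
      split_ifs with h
      · rfl
      · exact (x.2.1 a h b).symm)
    (by
      intro i j hij
      ext x a b
      refine (keepRow_apply j a b _).trans ?_
      split_ifs with h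
      · exact x.2.1 a (fun h' => hij (h'.symm.trans h)) b
      · rfl)
    (by
      ext x a b
      rw [ModuleCat.hom_sum, LinearMap.sum_apply]
      change ((∑ i, _ : strictRows k α Set.univ).1.1) a b = x.1.1 a b
      rw [AddSubmonoidClass.coe_finsetSum, AddSubmonoidClass.coe_finsetSum, Matrix.sum_apply]
      refine (Finset.sum_congr rfl fun i _ => keepRow_apply i a b x).trans ?_
      simp)
    m

/-- The morphism from the row `i` to `A_0` reading off the entry `(i, i + 1)`. -/
noncomputable def topMap (hα : α * α = 1) {i j : Fin n} (hij : i.val + 1 = j.val) :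
    strictRowsMod k α {i} ⟶ degreeZero k α :=
  ModuleCat.ofHom
    { toFun x := Submodule.Quotient.mk (shiftUp hα hij x.1 x.2.2)
      map_add' x y := by
        rw [← Submodule.Quotient.mk_add, Submodule.Quotient.eq]
        intro a
        change (shiftUp hα hij (x.1 + y.1) _).1 a a - ((shiftUp hα hij x.1 _).1 a a +
          (shiftUp hα hij y.1 _).1 a a) = 0
        by_cases h : a = j ∨ a = α j
        · simp only [shiftUp_diag hα hij _ _ h]
          exact sub_self _
        · push Not at h
          simp only [shiftUp_of_ne hα hij _ _ h.1 h.2]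
          simp
      map_smul' c x := by
        rw [RingHom.id_apply, ← Submodule.Quotient.mk_smul, Submodule.Quotient.eq]
        intro a
        change (shiftUp hα hij (x.1 * c.unop) _).1 a a - (shiftUp hα hij x.1 _ * c.unop).1 a a = 0
        rw [gentleAlgebra_mul_diag]
        by_cases h : a = j ∨ a = α j
        · have hc : c.unop.1 a a = c.unop.1 j j := by
            rcases h with rfl | rfl
            · rfl
            · exact c.unop.2.2 j
          simp only [shiftUp_diag hα hij _ _ h, hc]
          rw [sub_eq_zero]
          change (x.1.1 * c.unop.1) i j = _
          rw [Matrix.mul_apply]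
          refine Finset.sum_eq_single j (fun b _ hb => ?_) (fun h => absurd (Finset.mem_univ j) h)
          rcases lt_trichotomy b i with h | rfl | h
          · rw [x.1.2.1 i b h, zero_mul]
          · rw [x.2.2 b, zero_mul]
          · rw [c.unop.2.1 b j (by rw [Fin.lt_def] at *; rw [Ne, Fin.ext_iff] at hb; omega),
              mul_zero]
        · push Not at h
          simp only [shiftUp_of_ne hα hij _ _ h.1 h.2]
          simp }

theorem topMap_ne_zero (hα : α * α = 1) {i j : Fin n} (hij : i.val + 1 = j.val) :
    (topMap hα hij : strictRowsMod k α {i} ⟶ degreeZero k α) ≠ 0 := by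
  intro h
  have hlt : i < j := Fin.lt_def.2 (by omega)
  let x : strictRows k α {i} := ⟨unit i j hlt * 1, unit_mul_mem hlt 1⟩
  have h' : (Submodule.Quotient.mk (shiftUp hα hij x.1 x.2.2) :
      gentleAlgebra k α ⧸ positivePart k α) = 0 := congrArg (fun f => f.hom x) h
  have h'' := (Submodule.Quotient.mk_eq_zero _).1 h' j
  rw [shiftUp_diag hα hij _ _ (Or.inl rfl), unit_mul_same] at h''
  exact one_ne_zero ((Matrix.one_apply_eq j).symm.trans h'')

/-- A map is determined by the image `b` of the generator `E i j`. Modulo the radical, multiplying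
`b` by `shiftUp` retains only its diagonal entries at `j` and `α j`, which agree. -/
theorem exists_smul_topMap (hα : α * α = 1) {i j : Fin n} (hij : i.val + 1 = j.val)
    (f : strictRowsMod k α {i} ⟶ degreeZero k α) : 
    ∃ c : k, ∀ x, algebraMap k (gentleAlgebra k α)ᵐᵒᵖ c • (topMap hα hij).hom x = f.hom x := by
  have hlt : i < j := Fin.lt_def.2 (by omega)
  let u : strictRows k α {i} := ⟨unit i j hlt * 1, unit_mul_mem hlt 1⟩
  obtain ⟨b, hb⟩ := Submodule.Quotient.mk_surjective _ (f.hom u)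
  refine ⟨b.1 j j, fun x => ?_⟩
  have hx : x = MulOpposite.op (shiftUp hα hij x.1 x.2.2) • u := by
    refine Subtype.ext ?_
    change x.1 = unit i j hlt * 1 * shiftUp hα hij x.1 x.2.2
    rw [mul_one, unit_mul_shiftUp hα hij x.1 x.2]
  have hfx : f.hom x = Submodule.Quotient.mk (b * shiftUp hα hij x.1 x.2.2) := by
    conv_lhs => rw [hx]
    rw [map_smul, ← hb]
    rfl
  refine Eq.trans ?_ hfx.symm
  change (algebraMap k (gentleAlgebra k α)ᵐᵒᵖ (b.1 j j)) •
    (Submodule.Quotient.mk (shiftUp hα hij x.1 x.2.2) : gentleAlgebra k α ⧸ positivePart k α) = _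
  rw [← Submodule.Quotient.mk_smul, Submodule.Quotient.eq]
  intro a
  change (shiftUp hα hij x.1 _ * algebraMap k (gentleAlgebra k α) (b.1 j j)).1 a a -
    (b * shiftUp hα hij x.1 _).1 a a = 0
  rw [gentleAlgebra_mul_diag, gentleAlgebra_mul_diag]
  by_cases h : a = j ∨ a = α j
  · have hc : b.1 a a = b.1 j j := by
      rcases h with rfl | rfl
      · rfl
      · exact b.2.2 j
    have hd : (algebraMap k (gentleAlgebra k α) (b.1 j j)).1 a a = b.1 j j := by
      change (algebraMap k (Matrix (Fin n) (Fin n) k) (b.1 j j)) a a = _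
      rw [Matrix.algebraMap_matrix_apply, if_pos rfl]
      rfl
    rw [hc, hd, mul_comm, sub_self]
  · push Not at h
    simp only [shiftUp_of_ne hα hij _ _ h.1 h.2]
    simp

/-- `Alive α m i` means that the arrow `i` can be followed by `m` arrows such that all consecutive
products vanish in the gentle algebra. -/
def Alive (α : Perm (Fin n)) : ℕ → Fin n → Prop
  | 0, i => i.val + 1 < n
  | m + 1, i => i.val + 1 < n ∧ α (finRotate n i) ≠ finRotate n i ∧
      Alive α m (α (finRotate n i))

theorem val_finRotate {i : Fin n} (hi : i.val + 1 < n) : i.val + 1 = (finRotate n i).val := by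
  cases n with
  | zero => exact i.elim0
  | succ n => exact (coe_finRotate_of_ne_last (by rw [Ne, Fin.ext_iff, Fin.val_last]; omega)).symm

-- The recursion defining `Alive` mirrors the syzygies: row `i` leads to row `α (i + 1)`, a fixed
-- point `i + 1` gives the zero module, and so does the last row, which has no entry above the
-- diagonal.
open Classical in
theorem finrank_ext_row (hα : α * α = 1) (m : ℕ) (i : Fin n) :
    Module.Finite k (Abelian.Ext.{u} (strictRowsMod k α {i}) (degreeZero k α) m) ∧
      finrank k (Abelian.Ext.{u} (strictRowsMod k α {i}) (degreeZero k α) m) =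
        if Alive α m i then 1 else 0 := by
  have : Fact (α * α = 1) := ⟨hα⟩
  have zero_of_subsingleton : ∀ (s : Set (Fin n)) (m : ℕ), (∀ i ∈ s, i.val + 1 = n) →
      Module.Finite k (Abelian.Ext.{u} (strictRowsMod k α s) (degreeZero k α) m) ∧
      finrank k (Abelian.Ext.{u} (strictRowsMod k α s) (degreeZero k α) m) = 0 := by
    intro s m h
    have : Subsingleton (strictRowsMod k α s) := subsingleton_strictRows_of_forall _ h
    have := subsingleton_ext_of_subsingleton (strictRowsMod k α s) (degreeZero k α) m
    exact ⟨inferInstance, finrank_zero_of_subsingleton⟩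
  induction m generalizing i with
  | zero =>
    by_cases hi : i.val + 1 < n
    · rw [if_pos (show Alive α 0 i from hi)]
      have hij := val_finRotate hi
      have h := finrank_ext_zero_eq_one k _ (topMap_ne_zero hα hij) (exists_smul_topMap hα hij)
      exact ⟨Module.finite_of_finrank_eq_succ h, h⟩
    · rw [if_neg (show ¬ Alive α 0 i from hi)]
      exact zero_of_subsingleton _ _ (fun a ha => by rw [Set.mem_singleton_iff.1 ha]; have := i.2; omega)
  | succ m ih =>
    by_cases hi : i.val + 1 < n
    · have hij := val_finRotate hi
      let e : Abelian.Ext.{u} (strictRowsMod k α (syzygyIndex α (finRotate n i)))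
          (degreeZero k α) m ≃ₗ[k]
          Abelian.Ext.{u} (strictRowsMod k α {i}) (degreeZero k α) (m + 1) :=
        extShiftEquiv k (syzygyComplex_shortExact (k := k) hα hij) (degreeZero k α)
          (syzygyComplex_comp_eq_zero hα _) m
      by_cases hj : α (finRotate n i) = finRotate n i
      · rw [if_neg (fun h => h.2.1 hj)]
        have h := zero_of_subsingleton (syzygyIndex α (finRotate n i)) m
          (fun a ha => absurd (ha.1.trans hj) ha.2)
        have := h.1
        exact ⟨Module.Finite.equiv e, e.finrank_eq.symm.trans h.2⟩
      · have hs : syzygyIndex α (finRotate n i) = {α (finRotate n i)} := by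
          ext a
          exact ⟨fun h => h.1, fun h => ⟨h, fun h' => hj (h.symm.trans h')⟩⟩
        have h := ih (α (finRotate n i))
        rw [← hs] at h
        have := h.1
        refine ⟨Module.Finite.equiv e, (e.finrank_eq.symm.trans h.2).trans ?_⟩
        exact if_congr ⟨fun h => ⟨hi, hj, h⟩, fun h => h.2.2⟩ rfl rfl
    · rw [if_neg (fun h => hi h.1)]
      exact zero_of_subsingleton _ _ (fun a ha => by rw [Set.mem_singleton_iff.1 ha]; have := i.2; omega)

open Classical in
theorem finrank_ext_degreeZero (hα : α * α = 1) (m : ℕ) :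
    Module.Finite k (Abelian.Ext.{u} (degreeZero k α) (degreeZero k α) (m + 1)) ∧
      finrank k (Abelian.Ext.{u} (degreeZero k α) (degreeZero k α) (m + 1)) =
        (Finset.univ.filter (Alive α m)).card := by
  let e := (extRowsEquiv k α (degreeZero k α) m).symm.trans (extShiftEquiv k
    (radicalComplex_shortExact (k := k) (α := α)) (degreeZero k α) radicalComplex_comp_eq_zero m)
  have := fun i => (finrank_ext_row (k := k) hα m i).1
  refine ⟨Module.Finite.equiv e, e.finrank_eq.symm.trans ?_⟩
  rw [Module.finrank_pi_fintype, Finset.sum_congr rfl fun i _ => (finrank_ext_row hα m i).2,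
    Finset.card_filter]

end Syzygies

/-! ### The radical of a gentle algebra as its set of nilpotent elements. -/

section Radical

variable {k : Type u} [Field k] {n : ℕ} {α : Perm (Fin n)}

theorem gentleAlgebra_pow_diag (x : gentleAlgebra k α) (p : ℕ) (i : Fin n) :
    (x ^ p).1 i i = x.1 i i ^ p := by
  induction p with
  | zero =>
    rw [pow_zero, pow_zero]
    exact Matrix.one_apply_eq i
  | succ p ih => rw [pow_succ, pow_succ, gentleAlgebra_mul_diag, ih]

variable (k α) in
/-- The strictly upper triangular matrices as a linear subspace of the gentle algebra. -/
def radical : Submodule k (gentleAlgebra k α) where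
  carrier := {M | ∀ i, M.1 i i = 0}
  zero_mem' := fun _ => rfl
  add_mem' := fun {M N} hM hN i => by
    change M.1 i i + N.1 i i = 0
    rw [hM i, hN i, add_zero]
  smul_mem' := fun c M hM i => by
    change c * M.1 i i = 0
    rw [hM i, mul_zero]

theorem pow_eq_zero_of_mem_radical {x : gentleAlgebra k α} (hx : x ∈ radical k α) :
    x ^ n = 0 := by
  -- Each factor pushes the support one superdiagonal further up.
  have key : ∀ p : ℕ, ∀ i j : Fin n, j.val < i.val + p → (x ^ p).1 i j = 0 := by
    intro p
    induction p with
    | zero => exact fun i j h => (x ^ 0).2.1 i j (Fin.lt_def.2 (by omega))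
    | succ p ih =>
      intro i j h
      rw [pow_succ]
      change ((x ^ p).1 * x.1) i j = 0
      rw [Matrix.mul_apply]
      refine Finset.sum_eq_zero fun l _ => ?_
      by_cases hl : l.val < i.val + p
      · rw [ih i l hl, zero_mul]
      · rcases lt_trichotomy j l with h' | rfl | h'
        · rw [x.2.1 l j h', mul_zero]
        · rw [hx j, mul_zero]
        · rw [Fin.lt_def] at h'
          omega
  ext i j
  exact key n i j (by have := j.2; omega)

theorem mem_radical_of_pow_eq_zero {x : gentleAlgebra k α} {p : ℕ} (hx : x ^ p = 0) :
    x ∈ radical k α := by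
  intro i
  refine eq_zero_of_pow_eq_zero (n := p) ?_
  rw [← gentleAlgebra_pow_diag, hx]
  rfl

variable (k α) in
/-- A strictly upper triangular matrix amounts to its entries above the diagonal. -/
def radicalEquiv : radical k α ≃ₗ[k] ∀ i : Fin n, {j // i < j} → k where
  toFun x i j := x.1.1 i j
  invFun f := ⟨⟨Matrix.of fun i j => if h : i < j then f i ⟨j, h⟩ else 0,
    fun i j hij => dif_neg hij.asymm, fun i => by simp⟩, fun i => dif_neg (lt_irrefl i)⟩
  map_add' x y := rfl
  map_smul' c x := rfl
  left_inv x := by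
    ext i j
    change (if h : i < j then x.1.1 i j else 0) = x.1.1 i j
    split_ifs with h
    · rfl
    · rcases lt_or_eq_of_le (not_lt.1 h) with h | rfl
      · exact (x.1.2.1 i j h).symm
      · exact (x.2 j).symm
  right_inv f := by
    ext i j
    exact dif_pos j.2

theorem finrank_radical : finrank k (radical k α) = ∑ i : Fin n, (n - 1 - i.val) := by
  rw [(radicalEquiv k α).finrank_eq, Module.finrank_pi_fintype]
  refine Finset.sum_congr rfl fun i _ => ?_
  rw [Module.finrank_fintype_fun_eq_card, Fintype.card_subtype, ← Fin.card_Ioi]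
  congr 1
  ext j
  simp

end Radical

/-! ### Matching the positive part of the Yoneda algebra with the radical. -/

section Yoneda

variable {k : Type u} [Field k] {n : ℕ} {α β : Perm (Fin n)}

theorem exists_pow_of_yoneda {A B : Type u} [Ring A] [Algebra k A] [Ring B] [Algebra k B]
    {M : ModuleCat.{u} Aᵐᵒᵖ} (φ : (⨁ i : ℕ, Abelian.Ext.{u} M M i) ≃ₗ[k] B)
    (hφ : ∀ (i j m : ℕ) (h : j + i = m) (x : Abelian.Ext.{u} M M i) (y : Abelian.Ext.{u} M M j),
      φ (DirectSum.lof k ℕ (fun i => Abelian.Ext.{u} M M i) m (y.comp x h)) =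
        φ (DirectSum.lof k ℕ (fun i => Abelian.Ext.{u} M M i) i x) *
          φ (DirectSum.lof k ℕ (fun i => Abelian.Ext.{u} M M i) j y))
    {i : ℕ} (x : Abelian.Ext.{u} M M i) (p : ℕ) :
    ∃ z : Abelian.Ext.{u} M M ((p + 1) * i),
      φ (DirectSum.lof k ℕ (fun i => Abelian.Ext.{u} M M i) _ z) =
        φ (DirectSum.lof k ℕ (fun i => Abelian.Ext.{u} M M i) i x) ^ (p + 1) := by
  induction p with
  | zero =>
    -- The degree is replaced by a variable so that the dependent type of `z` can be identified with
    -- that of `x`.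
    obtain ⟨j, hj⟩ : ∃ j, j = (0 + 1) * i := ⟨_, rfl⟩
    rw [← hj]
    obtain rfl : j = i := by omega
    exact ⟨x, by rw [zero_add, pow_one]⟩
  | succ p ih =>
    obtain ⟨z, hz⟩ := ih
    exact ⟨x.comp z (by ring), by rw [hφ, hz, ← pow_succ]⟩

theorem mk₀_pow_of_yoneda {A B : Type u} [Ring A] [Algebra k A] [Ring B] [Algebra k B]
    {M : ModuleCat.{u} Aᵐᵒᵖ} (φ : (⨁ i : ℕ, Abelian.Ext.{u} M M i) ≃ₗ[k] B)
    (hφ : ∀ (i j m : ℕ) (h : j + i = m) (x : Abelian.Ext.{u} M M i) (y : Abelian.Ext.{u} M M j),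
      φ (DirectSum.lof k ℕ (fun i => Abelian.Ext.{u} M M i) m (y.comp x h)) =
        φ (DirectSum.lof k ℕ (fun i => Abelian.Ext.{u} M M i) i x) *
          φ (DirectSum.lof k ℕ (fun i => Abelian.Ext.{u} M M i) j y))
    (f : M ⟶ M) (p : ℕ) :
    φ (DirectSum.lof k ℕ (fun i => Abelian.Ext.{u} M M i) 0
        (Abelian.Ext.mk₀ (ModuleCat.ofHom (f.hom ^ (p + 1))))) =
      φ (DirectSum.lof k ℕ (fun i => Abelian.Ext.{u} M M i) 0 (Abelian.Ext.mk₀ f)) ^ (p + 1) := by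
  induction p with
  | zero => simp
  | succ p ih =>
    rw [pow_succ (φ _) (p + 1), ← ih, ← hφ 0 0 0 rfl, Abelian.Ext.mk₀_comp_mk₀]
    rfl

/-- An endomorphism of `A_0` is left multiplication by some `b` and depends only on the diagonal of
`b`, whose entries lie in a field. So degree zero of the Yoneda algebra has no nonzero nilpotents.
-/
theorem degreeZero_hom_eq_zero_of_pow {f : degreeZero k α ⟶ degreeZero k α} {p : ℕ}
    (hf : f.hom ^ p = 0) : f = 0 := by
  obtain ⟨b, hb⟩ := Submodule.Quotient.mk_surjective _
    (f.hom (Submodule.Quotient.mk (1 : gentleAlgebra k α)))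
  have hmul : ∀ a : gentleAlgebra k α,
      f.hom (Submodule.Quotient.mk a) = Submodule.Quotient.mk (b * a) := by
    intro a
    have ha : (Submodule.Quotient.mk a : gentleAlgebra k α ⧸ positivePart k α) =
        MulOpposite.op a • Submodule.Quotient.mk (1 : gentleAlgebra k α) :=
      congrArg Submodule.Quotient.mk (one_mul a).symm
    rw [ha]
    refine (map_smul f.hom _ _).trans ?_
    rw [← hb]
    rfl
  have hpow : ∀ q : ℕ, (f.hom ^ q) (Submodule.Quotient.mk (1 : gentleAlgebra k α)) =
      Submodule.Quotient.mk (b ^ q) := by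
    intro q
    induction q with
    | zero => rfl
    | succ q ih =>
      rw [pow_succ', Module.End.mul_apply, ih, hmul, ← pow_succ']
  have hbp : b ^ p ∈ positivePart k α := by
    rw [← Submodule.Quotient.mk_eq_zero, ← hpow, hf]
    rfl
  refine ModuleCat.hom_ext (LinearMap.ext fun x => ?_)
  obtain ⟨a, rfl⟩ := Submodule.Quotient.mk_surjective _ x
  refine (hmul a).trans ((Submodule.Quotient.mk_eq_zero _).2 fun i => ?_)
  have hbi := hbp i
  rw [gentleAlgebra_pow_diag] at hbi
  rw [gentleAlgebra_mul_diag, eq_zero_of_pow_eq_zero hbi, zero_mul]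

theorem Alive.of_succ {m : ℕ} {i : Fin n} (h : Alive α (m + 1) i) : Alive α m i := by
  induction m generalizing i with
  | zero => exact h.1
  | succ m ih => exact ⟨h.1, h.2.1, ih h.2.2⟩

theorem Alive.of_le {m m' : ℕ} (hm : m ≤ m') {i : Fin n} (h : Alive α m' i) : Alive α m i := by
  induction hm with
  | refl => exact h
  | step _ ih => exact ih h.of_succ

theorem sum_lof_succ_injective {V : ℕ → Type u} [∀ i, AddCommGroup (V i)] [∀ i, Module k (V i)]
    (N : ℕ) : Function.Injective
      (LinearMap.lsum k (fun m : Fin N => V (m + 1)) k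
        (fun m : Fin N => DirectSum.lof k ℕ V (m + 1))) := by
  rw [injective_iff_map_eq_zero]
  intro x hx
  ext m
  have h := congrArg (fun v => v (m.val + 1)) hx
  simp only [LinearMap.lsum_apply, LinearMap.sum_apply, LinearMap.comp_apply,
    LinearMap.proj_apply, DirectSum.zero_apply] at h
  rw [DFinsupp.finsetSum_apply, Finset.sum_eq_single m] at h
  · rwa [DirectSum.lof_apply] at h
  · intro j _ hj
    exact DirectSum.of_eq_of_ne _ _ _ (fun h => hj (Fin.ext (by omega)))
  · exact fun h => absurd (Finset.mem_univ m) h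

-- Finite dimension of `A_β` bounds the degrees, so classes of positive degree are nilpotent and
-- land in the radical. Conversely, the degree zero component of the preimage of a radical element
-- also maps into the radical, hence is nilpotent, hence zero. The positive part therefore has the
-- dimension of the radical.
open Classical in
theorem sum_card_alive_eq (hα : α * α = 1)
    (h : YonedaAlgebraIsoTo k (degreeZero k α) (gentleAlgebra k β)) :
    ∃ N, (∀ i, ¬ Alive α N i) ∧ ∑ m : Fin N, (Finset.univ.filter (Alive α m)).card =
      ∑ i : Fin n, (n - 1 - i.val) := by
  obtain ⟨φ, -, hφ⟩ := h
  let V : ℕ → Type u := fun i => Abelian.Ext.{u} (degreeZero k α) (degreeZero k α) i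
  have hfin : ∀ m, Module.Finite k (V (m + 1)) := fun m => (finrank_ext_degreeZero hα m).1
  have hrank : ∀ m, finrank k (V (m + 1)) = (Finset.univ.filter (Alive α m)).card :=
    fun m => (finrank_ext_degreeZero hα m).2
  let Ψ : ∀ N : ℕ, (∀ m : Fin N, V (m + 1)) →ₗ[k] gentleAlgebra k β := fun N =>
    φ.toLinearMap.comp (LinearMap.lsum k (fun m : Fin N => V (m + 1)) k
      (fun m : Fin N => DirectSum.lof k ℕ V (m + 1)))
  have hΨ : ∀ N, Function.Injective (Ψ N) := fun N =>
    φ.injective.comp (sum_lof_succ_injective N)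
  have hΨ_apply : ∀ N x, Ψ N x = ∑ m : Fin N, φ (DirectSum.lof k ℕ V (m + 1) (x m)) := by
    intro N x
    simp [Ψ, LinearMap.lsum_apply]
  have hΨ_rank : ∀ N, finrank k (∀ m : Fin N, V (m + 1)) =
      ∑ m : Fin N, (Finset.univ.filter (Alive α m)).card := fun N => by
    rw [Module.finrank_pi_fintype]
    exact Finset.sum_congr rfl fun m _ => hrank m
  have hβ : Module.Finite k (gentleAlgebra k β) :=
    Module.Finite.of_injective (gentleAlgebra k β).val.toLinearMap Subtype.val_injective
  -- Otherwise every positive degree contributes at least one dimension, and one degree more than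
  -- `dim A_β` is already too many.
  obtain ⟨N, hN⟩ : ∃ N, ∀ i, ¬ Alive α N i := by
    by_contra! hcon
    have h1 := LinearMap.finrank_le_finrank_of_injective (hΨ (finrank k (gentleAlgebra k β) + 1))
    rw [hΨ_rank] at h1
    have h2 : ∑ m : Fin (finrank k (gentleAlgebra k β) + 1), 1 ≤
        ∑ m : Fin (finrank k (gentleAlgebra k β) + 1),
          (Finset.univ.filter (Alive α m)).card := by
      refine Finset.sum_le_sum fun m _ => ?_
      obtain ⟨i, hi⟩ := hcon m
      exact Finset.card_pos.2 ⟨i, by simpa using hi⟩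
    simp only [Finset.sum_const, Finset.card_univ, Fintype.card_fin, smul_eq_mul, mul_one] at h2
    omega
  have hV : ∀ m, N < m → Subsingleton (V m) := by
    rintro (_ | m) hm
    · omega
    · have := hfin m
      refine (finrank_eq_zero_iff_of_free k _).1 ?_
      rw [hrank, Finset.card_eq_zero, Finset.filter_eq_empty_iff]
      exact fun i _ hi => hN i (hi.of_le (Nat.lt_succ_iff.1 hm))
  have hpos : ∀ m (x : V (m + 1)), φ (DirectSum.lof k ℕ V (m + 1) x) ∈ radical k β := by
    intro m x
    obtain ⟨z, hz⟩ := exists_pow_of_yoneda φ hφ x N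
    refine mem_radical_of_pow_eq_zero (p := N + 1) ?_
    have := hV ((N + 1) * (m + 1)) (by nlinarith)
    rw [← hz, Subsingleton.elim z 0, map_zero, map_zero]
  have hmem : ∀ x, Ψ N x ∈ radical k β := by
    intro x
    rw [hΨ_apply]
    exact Submodule.sum_mem _ fun m _ => hpos m _
  have hzero : ∀ x : V 0, φ (DirectSum.lof k ℕ V 0 x) ∈ radical k β → x = 0 := by
    intro x hx
    obtain ⟨f, rfl⟩ := (Abelian.Ext.mk₀_bijective _ _).2 x
    have h1 : φ (DirectSum.lof k ℕ V 0 (Abelian.Ext.mk₀ f)) ^ (n + 1) = 0 := by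
      rw [pow_succ, pow_eq_zero_of_mem_radical hx, zero_mul]
    rw [← mk₀_pow_of_yoneda φ hφ, map_eq_zero_iff φ φ.injective] at h1
    have h2 := DirectSum.of_injective (β := V) 0 (h1.trans (map_zero _).symm)
    rw [Abelian.Ext.mk₀_eq_zero_iff] at h2
    rw [degreeZero_hom_eq_zero_of_pow (congrArg ModuleCat.Hom.hom h2), Abelian.Ext.mk₀_zero]
  have hsurj : ∀ y ∈ radical k β, ∃ x, Ψ N x = y := by
    intro y hy
    let v := φ.symm y
    have hv : v = DirectSum.lof k ℕ V 0 (v 0) +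
        ∑ m : Fin N, DirectSum.lof k ℕ V (m + 1) (v (m + 1)) := by
      refine DFinsupp.ext fun i => ?_
      rw [DirectSum.add_apply, DFinsupp.finsetSum_apply]
      rcases i with _ | i
      · rw [DirectSum.lof_apply, Finset.sum_eq_zero, add_zero]
        exact fun m _ => DirectSum.of_eq_of_ne _ _ _ (by omega)
      · rw [show (DirectSum.lof k ℕ V 0 (v 0)) (i + 1) = 0 from
          DirectSum.of_eq_of_ne _ _ _ (by omega), zero_add]
        by_cases hi : i < N
        · rw [Finset.sum_eq_single ⟨i, hi⟩]
          · exact (DirectSum.lof_apply k (i + 1) (v (i + 1))).symm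
          · intro j _ hj
            exact DirectSum.of_eq_of_ne _ _ _ (fun h => hj (Fin.ext (by simp; omega)))
          · exact fun h => absurd (Finset.mem_univ _) h
        · have := hV (i + 1) (by omega)
          exact Subsingleton.elim _ _
    have hy' : y = φ (DirectSum.lof k ℕ V 0 (v 0)) + Ψ N fun m => v (m + 1) := by
      rw [hΨ_apply, ← map_sum, ← map_add, ← hv, LinearEquiv.apply_symm_apply]
    have hv0 : v 0 = 0 := by
      refine hzero _ ?_
      rw [eq_sub_of_add_eq hy'.symm]
      exact Submodule.sub_mem _ hy (hmem _)
    refine ⟨fun m => v (m + 1), ?_⟩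
    rw [hy', hv0, map_zero, map_zero, zero_add]
  refine ⟨N, hN, ?_⟩
  rw [← hΨ_rank, ← finrank_radical (k := k) (α := β)]
  exact (LinearEquiv.ofBijective ((Ψ N).codRestrict (radical k β) hmem)
    ⟨fun x y hxy => hΨ N (congrArg Subtype.val hxy), fun y => by
      obtain ⟨x, hx⟩ := hsurj y.1 y.2
      exact ⟨x, Subtype.ext hx⟩⟩).finrank_eq

end Yoneda

/-! ### Chains of arrows, fixed points and cycle structure. -/

section Combinatorics

variable {k : Type u} [Field k] {n : ℕ} {α β : Perm (Fin n)}

open Classical in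
theorem card_alive_zero_le (hn : 0 < n) :
    (Finset.univ.filter (Alive α 0)).card ≤ n - 1 := by
  have h : Finset.univ.filter (Alive α 0) ⊆ Finset.univ.erase ⟨n - 1, by omega⟩ := by
    intro i hi
    have hi' : i.val + 1 < n := (Finset.mem_filter.1 hi).2
    refine Finset.mem_erase.2 ⟨fun h => ?_, Finset.mem_univ i⟩
    rw [Fin.ext_iff] at h
    simp only at h
    omega
  simpa using Finset.card_le_card h

-- If the count did not drop, every arrow alive for `m` steps would be alive for `m + 1`, so its
-- successor would again be alive for `m` steps, and the chain would never end.
open Classical in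
theorem card_alive_succ_lt {N : ℕ} (hN : ∀ i, ¬ Alive α N i) {m : ℕ}
    (hm : (Finset.univ.filter (Alive α m)).Nonempty) :
    (Finset.univ.filter (Alive α (m + 1))).card < (Finset.univ.filter (Alive α m)).card := by
  refine Finset.card_lt_card ⟨Finset.monotone_filter_right _ fun i _ hi => hi.of_succ, fun h => ?_⟩
  have step : ∀ i, Alive α m i → Alive α (m + 1) i := fun i hi =>
    (Finset.mem_filter.1 (h (Finset.mem_filter.2 ⟨Finset.mem_univ i, hi⟩))).2
  have all : ∀ q i, Alive α m i → Alive α (m + q) i := by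
    intro q
    induction q with
    | zero => exact fun i hi => hi
    | succ q ih =>
      intro i hi
      have h1 := step i hi
      exact ⟨h1.1, h1.2.1, ih _ h1.2.2⟩
  obtain ⟨i, hi⟩ := hm
  exact hN i ((all N i (Finset.mem_filter.1 hi).2).of_le (by omega))

open Classical in
theorem card_alive_le (hn : 0 < n) {N : ℕ} (hN : ∀ i, ¬ Alive α N i) (m : ℕ) :
    (Finset.univ.filter (Alive α m)).card ≤ n - 1 - m := by
  induction m with
  | zero => exact card_alive_zero_le hn
  | succ m ih =>
    rcases (Finset.univ.filter (Alive α m)).eq_empty_or_nonempty with h | h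
    · have : (Finset.univ.filter (Alive α (m + 1))).card ≤
          (Finset.univ.filter (Alive α m)).card :=
        Finset.card_le_card (Finset.monotone_filter_right _ fun i _ hi => hi.of_succ)
      rw [h, Finset.card_empty] at this
      omega
    · have := card_alive_succ_lt hN h
      omega

/-- If the Koszul dual exists, then all but one arrow can be followed by another one with zero
product. -/
theorem eq_of_not_alive_one (hn : 3 ≤ n) (hα : α * α = 1)
    (h : YonedaAlgebraIsoTo k (degreeZero k α) (gentleAlgebra k β)) {i j : Fin n}
    (hi : i.val + 1 < n) (hj : j.val + 1 < n) (hi' : ¬ Alive α 1 i) (hj' : ¬ Alive α 1 j) :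
    i = j := by
  classical
  obtain ⟨N, hN, hsum⟩ := sum_card_alive_eq hα h
  by_contra hij
  have h1 : (Finset.univ.filter (Alive α 1)).card < n - 1 - 1 := by
    have hsub : insert i (insert j (Finset.univ.filter (Alive α 1))) ⊆
        Finset.univ.filter (Alive α 0) := by
      intro a ha
      refine Finset.mem_filter.2 ⟨Finset.mem_univ a, ?_⟩
      rcases Finset.mem_insert.1 ha with rfl | ha
      · exact hi
      · rcases Finset.mem_insert.1 ha with rfl | ha
        · exact hj
        · exact (Finset.mem_filter.1 ha).2.of_succ
    have hle := (Finset.card_le_card hsub).trans (card_alive_zero_le (by omega))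
    rw [Finset.card_insert_of_notMem (by simp [hij, hi']),
      Finset.card_insert_of_notMem (by simp [hj'])] at hle
    omega
  rw [Fin.sum_univ_eq_sum_range (fun m => (Finset.univ.filter (Alive α m)).card) N,
    Fin.sum_univ_eq_sum_range (fun m => n - 1 - m) n] at hsum
  -- Both sums are extended to the common range `n + N`, which contains the index `1` of strict
  -- inequality. The extra terms `n - 1 - m` with `m ≥ n` are zero by truncated subtraction.
  have hle : ∑ m ∈ Finset.range N, (Finset.univ.filter (Alive α m)).card ≤
      ∑ m ∈ Finset.range (n + N), (Finset.univ.filter (Alive α m)).card :=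
    Finset.sum_le_sum_of_subset (Finset.range_mono (by omega))
  have hlt : ∑ m ∈ Finset.range (n + N), (Finset.univ.filter (Alive α m)).card <
      ∑ m ∈ Finset.range (n + N), (n - 1 - m) :=
    Finset.sum_lt_sum (fun m _ => card_alive_le (by omega) hN m)
      ⟨1, Finset.mem_range.2 (by omega), h1⟩
  rw [Finset.sum_range_add (fun m => n - 1 - m), Finset.sum_eq_zero (s := Finset.range N) (fun m _ => by omega)] at hlt
  omega

theorem finRotate_last_eq_zero (hn : 0 < n) :
    finRotate n ⟨n - 1, by omega⟩ = ⟨0, hn⟩ := by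
  cases n with
  | zero => omega
  | succ n => exact finRotate_last

theorem exists_zpow_finRotate_eq (hn : 2 ≤ n) (i j : Fin n) : ∃ l : ℤ, (finRotate n ^ l) i = j := by
  have h : ∀ i : Fin n, finRotate n i ≠ i := fun i => by
    rw [← Perm.mem_support, support_finRotate_of_le hn]
    exact Finset.mem_univ i
  exact (isCycle_finRotate_of_le hn).exists_zpow_eq (h i) (h j)

/-- With the fixed point rotated to index `1`, arrow `0` is the only one without continuation. This
forces `0` to be paired with `n - 1`; one more rotation pairs `1` with `0`, so that arrow `0`
continues itself indefinitely. -/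
theorem forall_ne_of_closed (hn : 3 ≤ n) {E : Set (Perm (Fin n))} (hE : E ⊆ quasiDiagrams n)
    (hrot : ClosedUnderRotations E) (hkos : ClosedUnderKoszulDual k E) (hα : α ∈ E) (i : Fin n) :
    α i ≠ i := by
  intro hi
  have hn0 : 0 < n := by omega
  obtain ⟨l, hl⟩ := exists_zpow_finRotate_eq (by omega) i (finRotate n ⟨0, hn0⟩)
  set γ := finRotate n ^ l * α * (finRotate n ^ l)⁻¹ with hγ_def
  have hγ : γ ∈ E := hrot α hα l
  have hfix : γ (finRotate n ⟨0, hn0⟩) = finRotate n ⟨0, hn0⟩ := by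
    rw [← hl, hγ_def]
    simp [hi]
  have h1 : (finRotate n ⟨0, hn0⟩).val = 1 :=
    (val_finRotate (i := (⟨0, hn0⟩ : Fin n)) (by simp; omega)).symm
  have hlast : γ ⟨0, hn0⟩ = ⟨n - 1, by omega⟩ := by
    -- If `q` were an arrow, its successor would be the last index, where no arrow starts. So `q`
    -- would be a second arrow without continuation, distinct from `0` because `1 ≠ n - 1`. Hence
    -- `q` is the last index.
    obtain ⟨q, hq⟩ := (finRotate n).surjective (γ⁻¹ ⟨n - 1, by omega⟩)
    have hγq : γ (finRotate n q) = ⟨n - 1, by omega⟩ := by rw [hq]; simp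
    obtain ⟨δ, -, hδ⟩ := hkos γ hγ
    by_cases hq' : q.val + 1 < n
    · have := eq_of_not_alive_one hn (hE hγ) hδ.2 (i := ⟨0, hn0⟩) (j := q) (by simp; omega) hq'
        (fun h => h.2.1 hfix) (fun h => by
          have h2 : (γ (finRotate n q)).val + 1 < n := h.2.2
          rw [hγq] at h2
          simp only at h2
          omega)
      rw [← this, hfix, Fin.ext_iff, h1] at hγq
      simp only at hγq
      omega
    · have hq2 : q = ⟨n - 1, by omega⟩ := Fin.ext (by have := q.2; simp only; omega)
      rwa [hq2, finRotate_last_eq_zero hn0] at hγq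
  have hγ' := hrot γ hγ 1
  rw [zpow_one] at hγ'
  set γ' := finRotate n * γ * (finRotate n)⁻¹ with hγ'_def
  have hloop : γ' (finRotate n ⟨0, hn0⟩) = ⟨0, hn0⟩ := by
    rw [hγ'_def]
    rw [Perm.mul_apply, Perm.mul_apply, Perm.inv_def, symm_apply_apply, hlast,
      finRotate_last_eq_zero hn0]
  have halive : ∀ m, Alive γ' m ⟨0, hn0⟩ := by
    intro m
    induction m with
    | zero => exact (by simp; omega : (0 : ℕ) + 1 < n)
    | succ m ih =>
      refine ⟨by simp; omega, fun h => ?_, by rwa [hloop]⟩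
      rw [hloop, Fin.ext_iff, h1] at h
      exact zero_ne_one h
  obtain ⟨δ, -, hδ⟩ := hkos γ' hγ'
  obtain ⟨N, hN, -⟩ := sum_card_alive_eq (hE hγ') hδ.2
  exact hN _ (halive N)

/-- Without fixed points an orbit of `αζ` avoiding the last index would stay alive forever. So every
orbit contains that index, and there is only one; conjugation by `ζ` carries `αζ` to `ζα`. -/
theorem sameCycle_of_not_alive (hn : 0 < n) (hfix : ∀ i, α i ≠ i) {N : ℕ}
    (hN : ∀ i, ¬ Alive α N i) (i j : Fin n) : (finRotate n * α).SameCycle i j := by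
  have key : ∀ m i, (∀ l : ℕ, ((α * finRotate n) ^ l) i ≠ ⟨n - 1, by omega⟩) → Alive α m i := by
    have hlt : ∀ i : Fin n, i ≠ ⟨n - 1, by omega⟩ → i.val + 1 < n := fun i hi => by
      rw [Ne, Fin.ext_iff] at hi
      simp only at hi
      omega
    intro m
    induction m with
    | zero => exact fun i hi => hlt i (hi 0)
    | succ m ih =>
      refine fun i hi => ⟨hlt i (hi 0), hfix _, ih _ fun l => ?_⟩
      have := hi (l + 1)
      rwa [pow_succ] at this
  have hlast : ∀ i, (α * finRotate n).SameCycle i ⟨n - 1, by omega⟩ := by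
    intro i
    by_contra h
    exact hN i (key N i fun l hl => h ⟨l, by rw [zpow_natCast, hl]⟩)
  have hconj : finRotate n * α = finRotate n * (α * finRotate n) * (finRotate n)⁻¹ := by group
  rw [hconj, Perm.sameCycle_conj]
  exact (hlast _).trans (hlast _).symm

theorem isMaximal_of_sameCycle (hn : 0 < n)
    (h : ∀ i j, (finRotate n * α).SameCycle i j) : IsMaximal α := by
  refine ⟨Set.univ, Set.ext fun w => ⟨?_, fun hw => ⟨⟨0, hn⟩, ?_⟩⟩⟩
  · rintro ⟨i, rfl⟩
    exact Set.eq_univ_of_forall (h i)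
  · rw [Set.mem_singleton_iff.1 hw]
    exact Set.eq_univ_of_forall (h _)

/-- Both `ζ` and `ζα` are `n`-cycles, so `α` is even. Being a product of `n / 2` disjoint
transpositions, it has sign `(-1) ^ (n / 2)`, so `n / 2` is even. -/
theorem four_dvd_of_sameCycle (hn : 2 ≤ n) (hα : α * α = 1) (hfix : ∀ i, α i ≠ i)
    (h : ∀ i j, (finRotate n * α).SameCycle i j) : 4 ∣ n := by
  have hα2 : α ^ 2 = 1 := by rw [pow_two, hα]
  have hne : ∀ i, (finRotate n * α) i ≠ i := by
    intro i hi
    have hall : ∀ j, j = i := fun j => ((h i j).eq_of_left hi).symm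
    have h0 := hall ⟨0, by omega⟩
    have h1 := hall ⟨1, by omega⟩
    rw [← h1, Fin.ext_iff] at h0
    exact zero_ne_one h0
  have hcycle : (finRotate n * α).IsCycle := ⟨⟨0, by omega⟩, hne _, fun j _ => h _ j⟩
  have hsupp : (finRotate n * α).support = Finset.univ :=
    Finset.eq_univ_of_forall fun i => Perm.mem_support.2 (hne i)
  have hsuppα : α.support = Finset.univ :=
    Finset.eq_univ_of_forall fun i => Perm.mem_support.2 (hfix i)
  have h2 : 2 ∣ n := by
    have := Perm.two_dvd_card_support hα2
    rwa [hsuppα, Finset.card_univ, Fintype.card_fin] at this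
  have hfp : Fintype.card (Function.fixedPoints α) = 0 :=
    Fintype.card_eq_zero_iff.2 ⟨fun x => hfix x.1 x.2⟩
  have hsign := hcycle.sign
  rw [hsupp, Finset.card_univ, Fintype.card_fin, map_mul, sign_finRotate,
    Perm.sign_of_pow_two_eq_one hα2, hfp, Fintype.card_fin, Nat.sub_zero] at hsign
  obtain ⟨m, rfl⟩ := h2
  rw [Nat.mul_div_cancel_left m two_pos, (even_two_mul m).neg_one_pow,
    Odd.neg_one_pow ⟨m - 1, by omega⟩] at hsign
  rcases Nat.even_or_odd m with hm | hm
  · obtain ⟨g, rfl⟩ := hm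
    exact ⟨g, by ring⟩
  · rw [hm.neg_one_pow] at hsign
    exact absurd hsign (by decide)

end Combinatorics

end QuasiDiagram

theorem proposition6p5 (k : Type u) [Field k] (n : ℕ) (hn : 3 ≤ n)
    (E : Set (Equiv.Perm (Fin n))) (hE : E ⊆ QuasiDiagram.quasiDiagrams n) (hne : E.Nonempty)
    (hrot : QuasiDiagram.ClosedUnderRotations E)
    (hkos : QuasiDiagram.ClosedUnderKoszulDual k E) :
    ∃ g : ℕ, n = 4 * g ∧ E ⊆ QuasiDiagram.maximalChordDiagrams n := by
  have hfix : ∀ α ∈ E, ∀ i, α i ≠ i := fun α hα =>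
    QuasiDiagram.forall_ne_of_closed hn hE hrot hkos hα
  have hcycle : ∀ α ∈ E, ∀ i j, (finRotate n * α).SameCycle i j := by
    intro α hα
    obtain ⟨β, -, hβ⟩ := hkos α hα
    obtain ⟨N, hN, -⟩ := QuasiDiagram.sum_card_alive_eq (hE hα) hβ.2
    exact QuasiDiagram.sameCycle_of_not_alive (by omega) (hfix α hα) hN
  obtain ⟨α, hα⟩ := hne
  obtain ⟨g, hg⟩ := QuasiDiagram.four_dvd_of_sameCycle (by omega) (hE hα) (hfix α hα)
    (hcycle α hα)
  exact ⟨g, hg, fun γ hγ => ⟨hE hγ, hfix γ hγ,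
    QuasiDiagram.isMaximal_of_sameCycle (by omega) (hcycle γ hγ)⟩⟩
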